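/- Let $p>1$, let $\boldsymbol X$ be a random vector in $\mathbb R^p$ and let $\boldsymbol X_1,\boldsymbol X_2,\dots$ be independent copies of $\boldsymbol X$. Let $W:\mathbb R^p\to\mathbb R$ be Lebesgue integrable with $W>0$ Lebesgue-a.e., and let $J_1,\dots,J_p:(0,1)\to\mathbb R$ be strictly monotone (each one strictly increasing or strictly decreasing). For each $n$ let $\widehat{\boldsymbol\mu}_n\in\mathbb R^p$ and $\widehat{\boldsymbol\Omega}_n\in\mathbb R^{p\times p}$ be estimators, i.e. functions of $(\boldsymbol X_1,\dots,\boldsymbol X_n)$, such that, almost surely, $\widehat{\boldsymbol\Omega}_n\to\widetilde{\boldsymbol\Omega}$ as $n\to\infty$ for some fixed invertible matrix $\widetilde{\boldsymbol\Omega}$ (so $\widehat{\boldsymbol\Omega}_n$ is invertible for all large $n$, almost surely). Assume that every component of $\widetilde{\boldsymbol\Omega}^{-1}\boldsymbol X$ has a continuous distribution function, as is the case when $\boldsymbol X$ has a density. Put $\widehat{\boldsymbol Z}_j=\widehat{\boldsymbol\Omega}_n^{-1}(\boldsymbol X_j-\widehat{\boldsymbol\mu}_n)$ for $1\le j\le n$,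 let $R^{(n)}_{j\ell}=\#\{i\le n:\widehat Z_{i\ell}\le\widehat Z_{j\ell}\}$ be the rank of $\widehat Z_{j\ell}$ among $\widehat Z_{1\ell},\dots,\widehat Z_{n\ell}$, let $Y_{j\ell}=J_\ell\big(R^{(n)}_{j\ell}/(n+1)\big)$, and set $$\tilde T_{n,\mathbf J,W}=n\int_{\mathbb R^p}\Big|\frac1n\sum_{j=1}^n e^{\imath\sum_{\ell=1}^p t_\ell Y_{j\ell}}-\prod_{\ell=1}^p\frac1n\sum_{j=1}^n e^{\imath t_\ell Y_{j\ell}}\Big|^2W(\boldsymbol t)\,d\boldsymbol t .$$ Suppose that $\boldsymbol X$ does not follow an independent component model, i.e. there are no $\boldsymbol\mu\in\mathbb R^p$, invertible matrix $\boldsymbol\Omega\in\mathbb R^{p\times p}$ and random vector $\boldsymbol Z$ with mutually independent components such that $\boldsymbol X=\boldsymbol\mu+\boldsymbol\Omega\boldsymbol Z$ almost surely. Then $\tilde T_{n,\mathbf J,W}\to+\infty$ almost surely as $n\to\infty$. -/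

import Mathlib

open MeasureTheory ProbabilityTheory Filter
open scoped Topology Matrix

noncomputable section

namespace ICMTest

/-- The null hypothesis on the random vector `X`: the independent component model `X = μ + Ω Z`
holds for some location `μ`, some full-rank mixing matrix `Ω` and some latent random vector `Z`
with mutually (totally) independent components. The location is absorbed in `μ`; no moments are
required. -/
def NullHypothesis {S : Type*} [MeasurableSpace S] (P : Measure S) {p : ℕ}
    (X : S → Fin p → ℝ) : Prop :=
  ∃ (μ : Fin p → ℝ) (Ω : Matrix (Fin p) (Fin p) ℝ) (Z : S → Fin p → ℝ),
    IsUnit Ω.det ∧ AEMeasurable Z P ∧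
    iIndepFun (fun (l : Fin p) (s : S) => Z s l) P ∧
    ∀ᵐ s ∂P, X s = μ + Ω *ᵥ Z s

/-- Estimated residuals `Ω⁻¹ (x_j - μ)` of the sample `x_1, …, x_n`. -/
def residual {n p : ℕ} (μ : Fin p → ℝ) (Ω : Matrix (Fin p) (Fin p) ℝ)
    (x : Fin n → Fin p → ℝ) (j : Fin n) : Fin p → ℝ :=
  Ω⁻¹ *ᵥ (x j - μ)

/-- The rank of `z_j` among `z_1, …, z_n`, a number in `{1, …, n}`. -/
def rank {n : ℕ} (z : Fin n → ℝ) (j : Fin n) : ℕ :=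
  (Finset.univ.filter fun i : Fin n => z i ≤ z j).card

/-- Scored componentwise ranks `J_l (R_{jl} / (n + 1))` of the vectors `z_1, …, z_n`. -/
def scoredRank {n p : ℕ} (J : Fin p → ℝ → ℝ) (z : Fin n → Fin p → ℝ)
    (j : Fin n) : Fin p → ℝ :=
  fun l => J l ((rank (fun i => z i l) j : ℝ) / ((n : ℝ) + 1))

/-- Joint empirical characteristic function of the vectors `y_1, …, y_n`. -/
def jointECF {n p : ℕ} (y : Fin n → Fin p → ℝ) (t : Fin p → ℝ) : ℂ :=
  (1 / (n : ℂ)) * ∑ j, Complex.exp (Complex.I * ((t ⬝ᵥ y j : ℝ) : ℂ))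

/-- Empirical characteristic function of the `l`-th components of `y_1, …, y_n`. -/
def marginalECF {n p : ℕ} (y : Fin n → Fin p → ℝ) (l : Fin p) (u : ℝ) : ℂ :=
  (1 / (n : ℂ)) * ∑ j, Complex.exp (Complex.I * ((u * y j l : ℝ) : ℂ))

/-- Joint empirical characteristic function minus the product of the marginal ones. -/
def contrast {n p : ℕ} (y : Fin n → Fin p → ℝ) (t : Fin p → ℝ) : ℂ :=
  jointECF y t - ∏ l, marginalECF y l (t l)

/-- The rank-based statistic `n ∫ |D(t)|² W(t) dt` computed from the sample `x_1, …, x_n`, where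
`D` is the contrast of the scored ranks of the residuals for the parameter values `μ`, `Ω`. -/
def rankStatistic {n p : ℕ} (W : (Fin p → ℝ) → ℝ) (J : Fin p → ℝ → ℝ)
    (μ : Fin p → ℝ) (Ω : Matrix (Fin p) (Fin p) ℝ) (x : Fin n → Fin p → ℝ) : ℝ :=
  (n : ℝ) * ∫ t : Fin p → ℝ, ‖contrast (scoredRank J (residual μ Ω x)) t‖ ^ 2 * W t

end ICMTest

end

/-! Fix a sample path and regard the index `j` as a random variable, uniform on `Fin n`. The scored
ranks then form a random vector with characteristic function `jointECF`, and the statistic is `n`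
times a weighted squared distance from independence. It suffices that this distance has a positive
limit. Almost surely the empirical measures converge weakly to the law of `X`
(`ae_tendstoInDistribution_uniformFin`). A normalized rank is, up to a factor tending to 1, an
empirical distribution function at its own data point, and these functions converge to the
continuous `F l` of the `l`-th component of `Z = Ωt⁻¹ X`. By extended continuous mapping the scored
ranks converge in law to `V l = J l (F l (Z l))` (`tendstoInDistribution_scoredRank`), and dominated
convergence passes the integral to the limit. Were the limit zero, the components of `V` would be
independent (`integral_charContrast_sq_pos`). Strict monotonicity of `J l` recovers the events `Z l
≤ c` from `V l`, so `Z` would have independent components and `X = Ωt Z` would be an independent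
component model. -/

namespace ICMTest

open scoped ENNReal

/-! ### Weak convergence of empirical measures and continuous mapping -/

/-- The uniform probability measure on `Fin n`. -/
noncomputable def uniformFin (n : ℕ) : Measure (Fin n) := (n : ℝ≥0∞)⁻¹ • Measure.count

instance isProbabilityMeasure_uniformFin (n : ℕ) [NeZero n] :
    IsProbabilityMeasure (uniformFin n) := by
  refine ⟨?_⟩
  simp [uniformFin, ENNReal.inv_mul_cancel, NeZero.ne n]

lemma integral_uniformFin {E : Type*} [NormedAddCommGroup E] [NormedSpace ℝ E] [CompleteSpace E]
    {n : ℕ} (f : Fin n → E) :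
    ∫ j, f j ∂uniformFin n = (n : ℝ)⁻¹ • ∑ j, f j := by
  simp [uniformFin, integral_smul_measure]

lemma uniformFin_real {n : ℕ} (s : Set (Fin n)) [DecidablePred (· ∈ s)] :
    (uniformFin n).real s = (n : ℝ)⁻¹ * (Finset.univ.filter (· ∈ s)).card := by
  have : Measure.count s = ((Finset.univ.filter (· ∈ s)).card : ℝ≥0∞) := by
    rw [← Measure.count_apply_finset]; congr 1; ext; simp
  simp [uniformFin, Measure.real, this]

/-- **Varadarajan's theorem**: the empirical measures of an i.i.d. sequence converge weakly to the
common law, almost surely. -/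
theorem ae_tendstoInDistribution_uniformFin {S E : Type*} [MeasurableSpace S] {P : Measure S}
    [IsProbabilityMeasure P] [TopologicalSpace E] [SecondCountableTopology E]
    [MeasurableSpace E] [BorelSpace E]
    {X : S → E} {Xs : ℕ → S → E} (hindep : iIndepFun Xs P)
    (hident : ∀ j, IdentDistrib (Xs j) X P P) :
    ∀ᵐ s ∂P, TendstoInDistribution (fun (n : ℕ) (j : Fin (n + 1)) => Xs j s) atTop X
      (fun n => uniformFin (n + 1)) P := by
  -- Countability lets the strong law hold on all of `A` off one null set; `A` is a π-system
  -- containing a basis, which suffices for weak convergence.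
  set A : Set (Set E) := generateSetAlgebra (TopologicalSpace.countableBasis E)
  have hAc : A.Countable := countable_generateSetAlgebra (TopologicalSpace.countable_countableBasis E)
  have hAalg : IsSetAlgebra A := isSetAlgebra_generateSetAlgebra
  have hAm : ∀ a ∈ A, MeasurableSet a := by
    intro a ha
    have h1 : MeasurableSpace.generateFrom A ≤ borel E := by
      rw [generateFrom_generateSetAlgebra_eq,
        ← (TopologicalSpace.isBasis_countableBasis E).borel_eq_generateFrom]
    rw [BorelSpace.measurable_eq (α := E)]
    exact h1 _ (MeasurableSpace.measurableSet_generateFrom ha)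
  have hlln : ∀ a ∈ A, ∀ᵐ s ∂P,
      Tendsto (fun n : ℕ => (∑ i ∈ Finset.range n, a.indicator (fun _ => (1 : ℝ)) (Xs i s)) / n)
        atTop (𝓝 ((P.map X).real a)) := by
    intro a ha
    have hm : Measurable (a.indicator (fun _ => (1 : ℝ))) := measurable_const.indicator (hAm a ha)
    have h := strong_law_ae_real (μ := P) (fun i s => a.indicator (fun _ => (1 : ℝ)) (Xs i s))
      ?_ ?_ ?_
    · have e : ∫ s, a.indicator (fun _ => (1 : ℝ)) (Xs 0 s) ∂P = (P.map X).real a := by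
        rw [← (hident 0).map_eq,
          ← integral_map (f := a.indicator (fun _ => (1 : ℝ))) (hident 0).aemeasurable_fst
          hm.aestronglyMeasurable]
        exact integral_indicator_one (hAm a ha)
      rw [e] at h
      exact h
    · refine Integrable.of_bound (hm.comp_aemeasurable
        (hident 0).aemeasurable_fst).aestronglyMeasurable 1 (ae_of_all _ fun s => ?_)
      by_cases hs : Xs 0 s ∈ a <;> simp [hs]
    · intro i j hij
      exact (hindep.indepFun hij).comp hm hm
    · intro i
      exact ((hident i).trans (hident 0).symm).comp hm
  have hall := (ae_ball_iff hAc).2 hlln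
  filter_upwards [hall] with s hs
  refine ⟨fun n => (measurable_of_finite _).aemeasurable, (hident 0).aemeasurable_snd, ?_⟩
  refine IsPiSystem.tendsto_probabilityMeasure_of_tendsto_of_mem (S := A)
    (fun a ha b hb _ => hAalg.isSetRing.inter_mem ha hb) hAm ?_ ?_
  · intro u hu x hx
    obtain ⟨v, hv, hxv, hvu⟩ :=
      (TopologicalSpace.isBasis_countableBasis E).exists_subset_of_mem_open hx hu
    exact ⟨v, self_subset_generateSetAlgebra hv,
      ((TopologicalSpace.isBasis_countableBasis E).isOpen hv).mem_nhds hxv, hvu⟩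
  · intro a ha
    rw [← NNReal.tendsto_coe]
    refine ((tendsto_add_atTop_iff_nat 1).2 (hs a ha)).congr fun n => ?_
    classical
    change _ = ((uniformFin (n + 1)).map (fun j : Fin (n + 1) => Xs j s)).real a
    rw [map_measureReal_apply (measurable_of_finite _) (hAm a ha), uniformFin_real,
      Finset.sum_range, div_eq_inv_mul, Finset.card_filter]
    push_cast
    simp [Set.indicator_apply]

/-- **Extended continuous mapping theorem**: if `X n` tends to `Z` in distribution and `h n y` tends
to `h' z` as `n` goes to infinity and `y` to `z`, for almost every value `z` of `Z`, then
`h n ∘ X n` tends to `h' ∘ Z` in distribution. -/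
theorem _root_.MeasureTheory.TendstoInDistribution.tendsto_comp {E F Ω' : Type*} {Ω : ℕ → Type*}
    {m : ∀ i, MeasurableSpace (Ω i)} {μ : (i : ℕ) → Measure (Ω i)}
    [∀ i, IsProbabilityMeasure (μ i)] {m' : MeasurableSpace Ω'} {μ' : Measure Ω'}
    [IsProbabilityMeasure μ'] [TopologicalSpace E] [TopologicalSpace.PseudoMetrizableSpace E]
    [MeasurableSpace E] [BorelSpace E]
    [PseudoEMetricSpace F] [MeasurableSpace F] [BorelSpace F]
    {X : (i : ℕ) → Ω i → E} {Z : Ω' → E} (hX : TendstoInDistribution X atTop Z μ μ')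
    {h : ℕ → E → F} {h' : E → F} (hm : ∀ n, AEMeasurable (fun ω => h n (X n ω)) (μ n))
    (hm' : AEMeasurable (fun ω => h' (Z ω)) μ')
    (hh : ∀ᵐ ω ∂μ', Tendsto (Function.uncurry h) (atTop ×ˢ 𝓝 (Z ω)) (𝓝 (h' (Z ω)))) :
    TendstoInDistribution (fun n ω => h n (X n ω)) atTop (fun ω => h' (Z ω)) μ μ' := by
  let := TopologicalSpace.pseudoMetrizableSpacePseudoMetric E
  refine ⟨hm, hm', tendsto_of_forall_isClosed_limsup_le' fun C hC => ?_⟩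
  -- Portmanteau needs a closed set independent of `n`: `K k` contains `h n ⁻¹' C` for every `n ≥
  -- k`, and by continuous convergence almost every value of `Z` in all `K k` is sent into `C` by
  -- `h'`.
  set K : ℕ → Set E := fun k => closure (⋃ i ≥ k, h i ⁻¹' C) with hK
  have hKanti : Antitone K := fun k l hkl =>
    closure_mono (Set.biUnion_subset_biUnion_left fun i hi => le_trans hkl hi)
  have hlim := tendsto_measure_iInter_atTop (μ := μ'.map Z) (s := K)
    (fun k => isClosed_closure.measurableSet.nullMeasurableSet) hKanti ⟨0, by
      have := Measure.isProbabilityMeasure_map hX.aemeasurable_limit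
      exact measure_ne_top _ _⟩
  have hle : (μ'.map Z) (⋂ k, K k) ≤ (μ'.map fun ω => h' (Z ω)) C := by
    rw [Measure.map_apply_of_aemeasurable hm' hC.measurableSet,
      Measure.map_apply_of_aemeasurable hX.aemeasurable_limit
        (MeasurableSet.iInter fun k => isClosed_closure.measurableSet)]
    refine measure_mono_ae ?_
    filter_upwards [hh] with ω hω hωK
    by_contra hC'
    have hev := hω (hC.isOpen_compl.mem_nhds hC')
    obtain ⟨p, hp, q, hq, hpq⟩ := eventually_prod_iff.1 hev
    obtain ⟨k, hk⟩ := eventually_atTop.1 hp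
    obtain ⟨y, hy, hyK⟩ := mem_closure_iff_nhds.1 (Set.mem_iInter.1 hωK k) _ hq
    simp only [Set.mem_iUnion] at hyK
    obtain ⟨i, hi, hyi⟩ := hyK
    exact hpq (hk i hi) hy hyi
  refine le_trans (ge_of_tendsto hlim (Eventually.of_forall fun k => ?_)) hle
  refine le_trans ?_ (ProbabilityMeasure.limsup_measure_closed_le_of_tendsto hX.tendsto
    (isClosed_closure : IsClosed (K k)))
  refine limsup_le_limsup ?_
  filter_upwards [eventually_ge_atTop k] with n hn
  change (μ n).map (fun ω => h n (X n ω)) C ≤ (μ n).map (X n) (K k)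
  rw [Measure.map_apply_of_aemeasurable (hm n) hC.measurableSet,
      Measure.map_apply_of_aemeasurable (hX.forall_aemeasurable n) isClosed_closure.measurableSet]
  exact measure_mono fun ω hω => subset_closure (Set.mem_iUnion₂.2 ⟨n, hn, hω⟩)

end ICMTest

/-! ### Continuous distribution functions, integral transforms and scores -/

namespace ICMTest

/-- Monotone functions converging pointwise to a function that is continuous at `z` converge
continuously at `z`. -/
lemma tendsto_uncurry_of_monotone {G : ℕ → ℝ → ℝ} (hG : ∀ n, Monotone (G n)) {F : ℝ → ℝ} {z : ℝ}
    (hF : ContinuousAt F z) (h : ∀ c, Tendsto (fun n => G n c) atTop (𝓝 (F c))) :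
    Tendsto (Function.uncurry G) (atTop ×ˢ 𝓝 z) (𝓝 (F z)) := by
  refine tendsto_order.2 ⟨fun a ha => ?_, fun a ha => ?_⟩
  -- Some `c < z` still has `F c > a`; monotonicity carries the bound at `c` to all points near `z`.
  · obtain ⟨c, hc, hcz⟩ := (((hF.eventually (lt_mem_nhds ha)).filter_mono
      (nhdsWithin_le_nhds (s := Set.Iio z))).and self_mem_nhdsWithin).exists
    filter_upwards [((h c).eventually (lt_mem_nhds hc)).prod_mk (Ioi_mem_nhds hcz)]
      with q hq
    exact hq.1.trans_le (hG q.1 hq.2.le)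
  · obtain ⟨c, hc, hcz⟩ := (((hF.eventually (gt_mem_nhds ha)).filter_mono
      (nhdsWithin_le_nhds (s := Set.Ioi z))).and self_mem_nhdsWithin).exists
    filter_upwards [((h c).eventually (gt_mem_nhds hc)).prod_mk (Iio_mem_nhds hcz)]
      with q hq
    exact (hG q.1 hq.2.le).trans_lt hq.1

section Cdf

variable (μ : Measure ℝ) [IsProbabilityMeasure μ] [NullSingletonClass μ]

lemma continuous_cdf : Continuous (cdf μ) := by
  refine continuous_iff_continuousAt.2 fun x => ?_
  rw [(monotone_cdf μ).continuousAt_iff_leftLim_eq_rightLim, StieltjesFunction.rightLim_eq]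
  have h : (cdf μ).measure {x} = 0 := by rw [measure_cdf]; exact measure_singleton x
  rw [StieltjesFunction.measure_singleton, ENNReal.ofReal_eq_zero] at h
  exact le_antisymm ((monotone_cdf μ).leftLim_le le_rfl) (by linarith)

/-- Two points `a ≤ b` of one level set satisfy `μ (a, b] = F b - F a = 0`. Inner regularity
supplies a compact piece with extreme points, since level sets at 0 and 1 may be unbounded. -/
lemma measure_cdf_eq (u : ℝ) : μ {z | cdf μ z = u} = 0 := by
  by_contra h
  have hcl : IsClosed {z | cdf μ z = u} :=
    isClosed_eq (continuous_cdf μ) continuous_const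
  obtain ⟨K, hK, hKc, hpos⟩ := hcl.measurableSet.exists_lt_isCompact_of_ne_top
    (measure_ne_top μ _) (pos_iff_ne_zero.2 h)
  obtain ⟨a, ha⟩ := hKc.exists_isLeast (nonempty_of_measure_ne_zero hpos.ne')
  obtain ⟨b, hb⟩ := hKc.exists_isGreatest (nonempty_of_measure_ne_zero hpos.ne')
  refine hpos.ne' (measure_mono_null (t := Set.Icc a b) (fun x hx => ⟨ha.2 hx, hb.2 hx⟩) ?_)
  have hab : μ (Set.Ioc a b) = 0 := by
    rw [← measure_cdf μ, StieltjesFunction.measure_Ioc, (hK ha.1 : cdf μ a = u),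
      (hK hb.1 : cdf μ b = u)]
    simp
  rwa [measure_congr (Ioc_ae_eq_Icc (μ := μ) (a := a) (b := b))] at hab

end Cdf

section Transform

variable {S : Type*} [MeasurableSpace S] {P : Measure S} {Z : S → ℝ}

lemma nullSingletonClass_map (hZ : AEMeasurable Z P) (hc : ∀ c, P {s | Z s = c} = 0) :
    NullSingletonClass (P.map Z) :=
  ⟨fun c => by rw [Measure.map_apply_of_aemeasurable hZ (measurableSet_singleton c)]; exact hc c⟩

/-- The probability integral transform of a random variable. -/
noncomputable def integralTransform (P : Measure S) (Z : S → ℝ) (s : S) : ℝ := cdf (P.map Z) (Z s)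

lemma aemeasurable_integralTransform (hZ : AEMeasurable Z P) :
    AEMeasurable (integralTransform P Z) P :=
  (monotone_cdf _).measurable.comp_aemeasurable hZ

lemma measure_integralTransform_eq [IsProbabilityMeasure P] (hZ : AEMeasurable Z P) (hc : ∀ c, P {s | Z s = c} = 0)
    (u : ℝ) : P {s | integralTransform P Z s = u} = 0 := by
  have := nullSingletonClass_map hZ hc
  have := Measure.isProbabilityMeasure_map hZ
  have h := measure_cdf_eq (P.map Z) u
  rwa [Measure.map_apply_of_aemeasurable hZ
    (measurableSet_eq_fun (monotone_cdf _).measurable measurable_const)] at h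

lemma ae_integralTransform_mem_Ioo [IsProbabilityMeasure P] (hZ : AEMeasurable Z P) (hc : ∀ c, P {s | Z s = c} = 0) :
    ∀ᵐ s ∂P, integralTransform P Z s ∈ Set.Ioo 0 1 := by
  have h0 : ∀ᵐ s ∂P, integralTransform P Z s ≠ 0 := measure_integralTransform_eq hZ hc 0 |>
    fun h => by simpa [ae_iff] using h
  have h1 : ∀ᵐ s ∂P, integralTransform P Z s ≠ 1 := measure_integralTransform_eq hZ hc 1 |>
    fun h => by simpa [ae_iff] using h
  filter_upwards [h0, h1] with s hs0 hs1
  exact ⟨(cdf_nonneg _ _).lt_of_ne hs0.symm, (cdf_le_one _ _).lt_of_ne hs1⟩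

variable {U : S → ℝ} {J : ℝ → ℝ}

/-- `J` is arbitrary off `(0, 1)`, but that interval carries the law of `U`. -/
lemma aemeasurable_score (hU : AEMeasurable U P) (hU01 : ∀ᵐ s ∂P, U s ∈ Set.Ioo 0 1)
    (hJ : StrictMonoOn J (Set.Ioo 0 1) ∨ StrictAntiOn J (Set.Ioo 0 1)) :
    AEMeasurable (fun s => J (U s)) P := by
  have hr : (P.map U).restrict (Set.Ioo 0 1) = P.map U :=
    Measure.restrict_eq_self_of_ae_mem ((ae_map_iff hU measurableSet_Ioo).2 hU01)
  have h : AEMeasurable J (P.map U) := by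
    rw [← hr]
    exact hJ.elim (fun h => aemeasurable_restrict_of_monotoneOn measurableSet_Ioo h.monotoneOn)
      fun h => aemeasurable_restrict_of_antitoneOn measurableSet_Ioo h.antitoneOn
  exact h.comp_aemeasurable hU

/-- A monotone function has countably many discontinuities, and `U` has no atoms. -/
lemma ae_continuousAt_score (hU0 : ∀ u, P {s | U s = u} = 0)
    (hU01 : ∀ᵐ s ∂P, U s ∈ Set.Ioo 0 1)
    (hJ : StrictMonoOn J (Set.Ioo 0 1) ∨ StrictAntiOn J (Set.Ioo 0 1)) :
    ∀ᵐ s ∂P, ContinuousAt J (U s) := by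
  have hD : {u | u ∈ Set.Ioo (0 : ℝ) 1 ∧ ¬ContinuousWithinAt J (Set.Ioo 0 1) u}.Countable :=
    hJ.elim (fun h => h.monotoneOn.countable_not_continuousWithinAt)
      fun h => h.antitoneOn.countable_not_continuousWithinAt
  have h : ∀ᵐ s ∂P, ∀ u ∈ {u | u ∈ Set.Ioo (0 : ℝ) 1 ∧ ¬ContinuousWithinAt J (Set.Ioo 0 1) u},
      U s ≠ u := (ae_ball_iff hD).2 fun u _ => by simpa [ae_iff] using hU0 u
  filter_upwards [h, hU01] with s hs hs01
  by_contra hc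
  exact hs (U s) ⟨hs01, fun h' => hc (h'.continuousAt (Ioo_mem_nhds hs01.1 hs01.2))⟩ rfl

end Transform

/-! ### Ranks as empirical distribution functions and their limit -/

lemma tendsto_measureReal_le_of_tendstoInDistribution {S : Type*} [MeasurableSpace S]
    {P : Measure S} [IsProbabilityMeasure P] {Ω : ℕ → Type*} {m : ∀ i, MeasurableSpace (Ω i)}
    {μ : (i : ℕ) → Measure (Ω i)} [∀ i, IsProbabilityMeasure (μ i)]
    {X : (i : ℕ) → Ω i → ℝ} {Z : S → ℝ} (hX : TendstoInDistribution X atTop Z μ P)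
    (hc : ∀ c, P {s | Z s = c} = 0) (c : ℝ) :
    Tendsto (fun n => (μ n).real {ω | X n ω ≤ c}) atTop (𝓝 (cdf (P.map Z) c)) := by
  have hZ := hX.aemeasurable_limit
  have := nullSingletonClass_map hZ hc
  have hP := Measure.isProbabilityMeasure_map hZ
  have h := ProbabilityMeasure.tendsto_measure_of_null_frontier_of_tendsto' hX.tendsto
    (E := Set.Iic c) (by simp)
  have h2 := (ENNReal.tendsto_toReal (measure_ne_top (P.map Z) (Set.Iic c))).comp h
  rw [cdf_eq_real]
  refine h2.congr fun n => ?_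
  change ((μ n).map (X n) (Set.Iic c)).toReal = _
  rw [Measure.map_apply_of_aemeasurable (hX.forall_aemeasurable n) measurableSet_Iic]
  rfl

lemma residual_apply {n p : ℕ} (m : Fin p → ℝ) (Ω : Matrix (Fin p) (Fin p) ℝ)
    (x : Fin n → Fin p → ℝ) (j : Fin n) (l : Fin p) :
    residual m Ω x j l = (Ω⁻¹ *ᵥ x j) l - (Ω⁻¹ *ᵥ m) l := by
  simp [residual, Matrix.mulVec_sub]

/-- The normalized rank is a multiple of the empirical distribution function. -/
lemma rank_residual_div {n p : ℕ} (m : Fin p → ℝ) (Ω : Matrix (Fin p) (Fin p) ℝ)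
    (x : Fin (n + 1) → Fin p → ℝ) (j : Fin (n + 1)) (l : Fin p) :
    (rank (fun i => residual m Ω x i l) j : ℝ) / (((n + 1 : ℕ) : ℝ) + 1) =
      ((n : ℝ) + 1) / ((n : ℝ) + 1 + 1) *
        (uniformFin (n + 1)).real {i | (Ω⁻¹ *ᵥ x i) l ≤ (Ω⁻¹ *ᵥ x j) l} := by
  classical
  rw [uniformFin_real]
  -- The location term cancels in every comparison, so the location estimator needs no convergence.
  simp only [rank, residual_apply, sub_le_sub_iff_right, Set.mem_ofPred_eq]
  have : (n : ℝ) + 1 ≠ 0 := by positivity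
  push_cast
  field_simp

/-- Only the limit must be invertible; the value 0 of the inverse at singular matrices can occur for
finitely many `n` only. -/
lemma tendsto_matrix_inv {p : ℕ} {Ω : ℕ → Matrix (Fin p) (Fin p) ℝ}
    {Ωt : Matrix (Fin p) (Fin p) ℝ} (hΩt : IsUnit Ωt.det) (hΩ : Tendsto Ω atTop (𝓝 Ωt)) :
    Tendsto (fun n => (Ω n)⁻¹) atTop (𝓝 Ωt⁻¹) := by
  have h : ContinuousAt (Ring.inverse : ℝ → ℝ) Ωt.det := by
    rw [Ring.inverse_eq_inv']
    exact continuousAt_inv₀ hΩt.ne_zero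
  exact Tendsto.comp (continuousAt_matrix_inv Ωt h) hΩ

lemma tendsto_mulVec_apply {p : ℕ} {A : ℕ → Matrix (Fin p) (Fin p) ℝ}
    {A₀ : Matrix (Fin p) (Fin p) ℝ} (hA : Tendsto A atTop (𝓝 A₀)) (z : Fin p → ℝ) (l : Fin p) :
    Tendsto (fun q : ℕ × (Fin p → ℝ) => (A q.1 *ᵥ q.2) l) (atTop ×ˢ 𝓝 z)
      (𝓝 ((A₀ *ᵥ z) l)) := by
  have hc : Continuous fun q : Matrix (Fin p) (Fin p) ℝ × (Fin p → ℝ) => (q.1 *ᵥ q.2) l :=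
    (continuous_apply l).comp (continuous_fst.matrix_mulVec continuous_snd)
  have h := hc.tendsto (A₀, z)
  have hq : Tendsto (fun q : ℕ × (Fin p → ℝ) => (A q.1, q.2)) (atTop ×ˢ 𝓝 z) (𝓝 (A₀, z)) := by
    rw [nhds_prod_eq]
    exact (hA.comp tendsto_fst).prodMk tendsto_snd
  exact h.comp hq

/-- The vectors of scored ranks of the residuals converge in distribution, under the empirical
measure of the sample, to the scored integral transforms of the pseudo-residual. -/
theorem tendstoInDistribution_scoredRank {S : Type*} [MeasurableSpace S] {P : Measure S}
    [IsProbabilityMeasure P] {p : ℕ} {X : S → Fin p → ℝ} {x : ℕ → Fin p → ℝ}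
    (hx : TendstoInDistribution (fun (n : ℕ) (j : Fin (n + 1)) => x j) atTop X
      (fun n => uniformFin (n + 1)) P)
    {J : Fin p → ℝ → ℝ}
    (hJ : ∀ l, StrictMonoOn (J l) (Set.Ioo 0 1) ∨ StrictAntiOn (J l) (Set.Ioo 0 1))
    (m : ℕ → Fin p → ℝ) {Ω : ℕ → Matrix (Fin p) (Fin p) ℝ} {Ωt : Matrix (Fin p) (Fin p) ℝ}
    (hΩt : IsUnit Ωt.det) (hΩ : Tendsto Ω atTop (𝓝 Ωt))
    (hcont : ∀ (l : Fin p) (c : ℝ), P {s | (Ωt⁻¹ *ᵥ X s) l = c} = 0) :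
    TendstoInDistribution
      (fun (n : ℕ) (j : Fin (n + 1)) =>
        scoredRank J (residual (m n) (Ω n) (fun i : Fin (n + 1) => x i)) j) atTop
      (fun s l => J l (integralTransform P (fun s => (Ωt⁻¹ *ᵥ X s) l) s))
      (fun n => uniformFin (n + 1)) P := by
  have hXm := hx.aemeasurable_limit
  have hlin : ∀ l, Continuous fun q : Matrix (Fin p) (Fin p) ℝ × (Fin p → ℝ) => (q.1 *ᵥ q.2) l :=
    fun l => (continuous_apply l).comp (continuous_fst.matrix_mulVec continuous_snd)
  have hZm : ∀ l, AEMeasurable (fun s => (Ωt⁻¹ *ᵥ X s) l) P := fun l =>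
    ((hlin l).comp (Continuous.prodMk_right Ωt⁻¹)).measurable.comp_aemeasurable hXm
  have hinv : Tendsto (fun n => (Ω n)⁻¹) atTop (𝓝 Ωt⁻¹) := tendsto_matrix_inv hΩt hΩ
  have hres : ∀ l z, Tendsto (fun q : ℕ × (Fin p → ℝ) => ((Ω q.1)⁻¹ *ᵥ q.2) l) (atTop ×ˢ 𝓝 z)
      (𝓝 ((Ωt⁻¹ *ᵥ z) l)) := fun l z => tendsto_mulVec_apply hinv z l
  have hcdf : ∀ l c, Tendsto (fun n : ℕ => (uniformFin (n + 1)).real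
      {j | ((Ω n)⁻¹ *ᵥ x j) l ≤ c}) atTop (𝓝 (cdf (P.map fun s => (Ωt⁻¹ *ᵥ X s) l) c)) := by
    intro l c
    exact tendsto_measureReal_le_of_tendstoInDistribution
      (hx.tendsto_comp (h := fun n y => ((Ω n)⁻¹ *ᵥ y) l) (h' := fun y => (Ωt⁻¹ *ᵥ y) l)
        (fun n => (measurable_of_finite _).aemeasurable) (hZm l)
        (ae_of_all _ fun s => hres l (X s))) (hcont l) c
  have hratio : Tendsto (fun n : ℕ => ((n : ℝ) + 1) / ((n : ℝ) + 1 + 1)) atTop (𝓝 1) := by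
    have := (tendsto_add_atTop_iff_nat 1).2 (tendsto_natCast_div_add_atTop (1 : ℝ))
    simpa using this
  obtain ⟨F, hF⟩ : ∃ F : Fin p → ℝ → ℝ, ∀ l, F l = cdf (P.map fun s => (Ωt⁻¹ *ᵥ X s) l) :=
    ⟨_, fun _ => rfl⟩
  -- Replacing the data point by a free threshold `c` turns the ranks into monotone functions on the
  -- whole line, as continuous mapping requires.
  obtain ⟨G, hG⟩ : ∃ G : Fin p → ℕ → ℝ → ℝ, ∀ l n c, G l n c =
      ((n : ℝ) + 1) / ((n : ℝ) + 1 + 1) *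
        (uniformFin (n + 1)).real {j | ((Ω n)⁻¹ *ᵥ x j) l ≤ c} := ⟨_, fun _ _ _ => rfl⟩
  have hFcont : ∀ l, Continuous (F l) := fun l => by
    have := nullSingletonClass_map (hZm l) (hcont l)
    have := Measure.isProbabilityMeasure_map (hZm l)
    rw [hF]
    exact continuous_cdf _
  have hGmono : ∀ l n, Monotone (G l n) := fun l n c d hcd => by
    rw [hG, hG]
    exact mul_le_mul_of_nonneg_left (measureReal_mono fun j hj => le_trans hj hcd) (by positivity)
  have hGlim : ∀ l c, Tendsto (fun n => G l n c) atTop (𝓝 (F l c)) := fun l c => by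
    simpa [hG, hF] using hratio.mul (hcdf l c)
  have hscore : (fun (n : ℕ) (j : Fin (n + 1)) =>
      scoredRank J (residual (m n) (Ω n) (fun i : Fin (n + 1) => x i)) j) =
      fun (n : ℕ) (j : Fin (n + 1)) l => J l (G l n (((Ω n)⁻¹ *ᵥ x j) l)) := by
    funext n j l
    rw [hG]
    exact congrArg (J l) (rank_residual_div (m n) (Ω n) (fun i : Fin (n + 1) => x i) j l)
  have hU : ∀ l s, integralTransform P (fun s => (Ωt⁻¹ *ᵥ X s) l) s = F l ((Ωt⁻¹ *ᵥ X s) l) :=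
    fun l s => by rw [hF, integralTransform]
  have hVm : AEMeasurable (fun s l => J l (F l ((Ωt⁻¹ *ᵥ X s) l))) P := by
    refine aemeasurable_pi_lambda _ fun l => ?_
    have := aemeasurable_score (aemeasurable_integralTransform (hZm l))
      (ae_integralTransform_mem_Ioo (hZm l) (hcont l)) (hJ l)
    simpa only [hU] using this
  have hae : ∀ᵐ s ∂P, ∀ l, ContinuousAt (J l) (F l ((Ωt⁻¹ *ᵥ X s) l)) := by
    refine ae_all_iff.2 fun l => ?_
    have := ae_continuousAt_score (measure_integralTransform_eq (hZm l) (hcont l))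
        (ae_integralTransform_mem_Ioo (hZm l) (hcont l)) (hJ l)
    simpa only [hU] using this
  simp only [hU]
  rw [hscore]
  refine hx.tendsto_comp (h := fun n y l => J l (G l n (((Ω n)⁻¹ *ᵥ y) l)))
    (h' := fun y l => J l (F l ((Ωt⁻¹ *ᵥ y) l)))
    (fun n => (measurable_of_finite _).aemeasurable) hVm ?_
  filter_upwards [hae] with s hs
  have hlim : ∀ l, Tendsto (fun q : ℕ × (Fin p → ℝ) => J l (G l q.1 (((Ω q.1)⁻¹ *ᵥ q.2) l)))
      (atTop ×ˢ 𝓝 (X s)) (𝓝 (J l (F l ((Ωt⁻¹ *ᵥ X s) l)))) := fun l =>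
    (hs l).tendsto.comp ((tendsto_uncurry_of_monotone (hGmono l)
      (hFcont l).continuousAt (hGlim l)).comp (tendsto_fst.prodMk (hres l (X s))))
  exact tendsto_pi_nhds.2 hlim

end ICMTest

/-! ### Characteristic functions and the contrast -/

namespace ICMTest

section Ecf

variable {S : Type*} [MeasurableSpace S] {P : Measure S} {p : ℕ}

lemma continuous_jointPhase (t : Fin p → ℝ) :
    Continuous fun v : Fin p → ℝ => Complex.exp (Complex.I * ((t ⬝ᵥ v : ℝ) : ℂ)) := by
  have : Continuous fun v : Fin p → ℝ => t ⬝ᵥ v := continuous_const.dotProduct continuous_id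
  fun_prop

lemma norm_phase (a : ℝ) : ‖Complex.exp (Complex.I * (a : ℂ))‖ = 1 := by
  rw [mul_comm]; exact Complex.norm_exp_ofReal_mul_I a

lemma jointECF_eq_integral {n : ℕ} (y : Fin n → Fin p → ℝ) (t : Fin p → ℝ) :
    jointECF y t = ∫ j, Complex.exp (Complex.I * ((t ⬝ᵥ y j : ℝ) : ℂ)) ∂uniformFin n := by
  rw [integral_uniformFin, jointECF, Complex.real_smul]
  simp

/-- Reduces limits and bounds for the marginals to the joint case. -/
lemma marginalECF_eq_jointECF {n : ℕ} (y : Fin n → Fin p → ℝ) (l : Fin p) (u : ℝ) :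
    marginalECF y l u = jointECF y (Pi.single l u) := by
  simp [marginalECF, jointECF]

lemma tendsto_jointECF [IsProbabilityMeasure P] {y : (n : ℕ) → Fin (n + 1) → Fin p → ℝ}
    {V : S → Fin p → ℝ}
    (hy : TendstoInDistribution y atTop V (fun n => uniformFin (n + 1)) P) (t : Fin p → ℝ) :
    Tendsto (fun n => jointECF (y n) t) atTop
      (𝓝 (∫ s, Complex.exp (Complex.I * ((t ⬝ᵥ V s : ℝ) : ℂ)) ∂P)) := by
  have h := (ProbabilityMeasure.tendsto_iff_forall_integral_rclike_tendsto ℂ).1 hy.tendsto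
    (BoundedContinuousFunction.ofNormedAddCommGroup _ (continuous_jointPhase t) 1
      fun v => (norm_phase _).le)
  have e : ∀ {Ω : Type _} [MeasurableSpace Ω] {μ : Measure Ω} {Y : Ω → Fin p → ℝ},
      AEMeasurable Y μ → ∫ v, Complex.exp (Complex.I * ((t ⬝ᵥ v : ℝ) : ℂ)) ∂(μ.map Y) =
        ∫ s, Complex.exp (Complex.I * ((t ⬝ᵥ Y s : ℝ) : ℂ)) ∂μ := fun hY =>
    integral_map hY (continuous_jointPhase t).aestronglyMeasurable
  have e' : ∫ v, Complex.exp (Complex.I * ((t ⬝ᵥ v : ℝ) : ℂ)) ∂(P.map V) =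
        ∫ s, Complex.exp (Complex.I * ((t ⬝ᵥ V s : ℝ) : ℂ)) ∂P :=
    integral_map hy.aemeasurable_limit (continuous_jointPhase t).aestronglyMeasurable
  rw [← e']
  refine h.congr fun n => ?_
  rw [jointECF_eq_integral, ← e (hy.forall_aemeasurable n)]
  rfl

/-- The characteristic function of a random vector minus the product of the marginal ones. -/
noncomputable def charContrast (P : Measure S) (V : S → Fin p → ℝ) (t : Fin p → ℝ) : ℂ :=
  (∫ s, Complex.exp (Complex.I * ((t ⬝ᵥ V s : ℝ) : ℂ)) ∂P) -
    ∏ l, ∫ s, Complex.exp (Complex.I * ((t l * V s l : ℝ) : ℂ)) ∂P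

lemma tendsto_contrast [IsProbabilityMeasure P] {y : (n : ℕ) → Fin (n + 1) → Fin p → ℝ}
    {V : S → Fin p → ℝ}
    (hy : TendstoInDistribution y atTop V (fun n => uniformFin (n + 1)) P) (t : Fin p → ℝ) :
    Tendsto (fun n => contrast (y n) t) atTop (𝓝 (charContrast P V t)) := by
  refine (tendsto_jointECF hy t).sub (tendsto_finsetProd _ fun l _ => ?_)
  simp only [marginalECF_eq_jointECF]
  simpa using tendsto_jointECF hy (Pi.single l (t l))

lemma continuous_charContrast [IsProbabilityMeasure P] {V : S → Fin p → ℝ}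
    (hV : AEMeasurable V P) : Continuous (charContrast P V) := by
  have hj : Continuous fun t : Fin p → ℝ =>
      ∫ s, Complex.exp (Complex.I * ((t ⬝ᵥ V s : ℝ) : ℂ)) ∂P := by
    refine continuous_of_dominated (bound := fun _ => 1)
      (fun t => ((continuous_jointPhase t).measurable.comp_aemeasurable hV).aestronglyMeasurable)
      (fun t => ae_of_all _ fun s => (norm_phase _).le) (integrable_const _)
      (ae_of_all _ fun s => ?_)
    have : Continuous fun t : Fin p → ℝ => t ⬝ᵥ V s := continuous_id.dotProduct continuous_const
    fun_prop
  refine hj.sub (continuous_finsetProd _ fun l _ => ?_)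
  have hs : Continuous fun t : Fin p → ℝ => Pi.single (M := fun _ => ℝ) l (t l) :=
    (continuous_single l).comp (continuous_apply l)
  simpa [Function.comp_def] using hj.comp hs

lemma norm_jointECF_le {n : ℕ} (y : Fin n → Fin p → ℝ) (t : Fin p → ℝ) : ‖jointECF y t‖ ≤ 1 := by
  have h : ‖∑ j, Complex.exp (Complex.I * ((t ⬝ᵥ y j : ℝ) : ℂ))‖ ≤ n := by
    refine (norm_sum_le _ _).trans ?_
    simp only [norm_phase]
    simp
  rw [jointECF, norm_mul, norm_div, norm_one, Complex.norm_natCast, one_div_mul_eq_div]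
  exact div_le_one_of_le₀ h (by positivity)

lemma norm_contrast_le {n : ℕ} (y : Fin n → Fin p → ℝ) (t : Fin p → ℝ) : ‖contrast y t‖ ≤ 2 := by
  have h : ‖∏ l, marginalECF y l (t l)‖ ≤ 1 := by
    rw [norm_prod]
    refine Finset.prod_le_one (fun _ _ => norm_nonneg _) fun l _ => ?_
    rw [marginalECF_eq_jointECF]
    exact norm_jointECF_le _ _
  calc ‖contrast y t‖ ≤ ‖jointECF y t‖ + ‖∏ l, marginalECF y l (t l)‖ := norm_sub_le _ _
    _ ≤ 1 + 1 := add_le_add (norm_jointECF_le _ _) h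
    _ = 2 := by norm_num

lemma continuous_contrast {n : ℕ} (y : Fin n → Fin p → ℝ) : Continuous (contrast y) := by
  have h : ∀ j, Continuous fun t : Fin p → ℝ => t ⬝ᵥ y j :=
    fun j => continuous_id.dotProduct continuous_const
  unfold contrast jointECF marginalECF
  fun_prop

/-- A vanishing contrast of characteristic functions means that the components are independent. -/
lemma iIndepFun_of_charContrast_eq_zero [IsProbabilityMeasure P] {V : S → Fin p → ℝ}
    (hV : AEMeasurable V P) (h : ∀ t, charContrast P V t = 0) :
    iIndepFun (fun l s => V s l) P := by
  have hVl : ∀ l, AEMeasurable (fun s => V s l) P := fun l =>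
    (measurable_pi_apply l).comp_aemeasurable hV
  rw [iIndepFun_iff_charFun_pi hVl]
  intro t
  have ht := sub_eq_zero.1 (h t.ofLp)
  rw [charFun_apply, integral_map (by fun_prop) (by fun_prop)]
  have e : ∀ l, charFun (P.map fun s => V s l) (t l) =
      ∫ s, Complex.exp (Complex.I * ((t l * V s l : ℝ) : ℂ)) ∂P := fun l => by
    rw [charFun_apply_real, integral_map (hVl l) (by fun_prop)]
    simp [mul_comm Complex.I]
  simp only [e]
  rw [← ht]
  refine integral_congr_ae (ae_of_all _ fun s => ?_)
  simp [PiLp.inner_apply, dotProduct, mul_comm Complex.I]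

end Ecf

/-! ### Transferring independence from scores to residuals -/

section Independence

variable {S : Type*} [MeasurableSpace S] {P : Measure S} [IsProbabilityMeasure P]

/-- The equivalence can fail only where `Z > c` on a flat stretch of the distribution function, and
such a level set is null. -/
lemma ae_le_iff_integralTransform_le {Z : S → ℝ} (hZ : AEMeasurable Z P)
    (hc : ∀ c, P {s | Z s = c} = 0) (c : ℝ) :
    ∀ᵐ s ∂P, Z s ≤ c ↔ integralTransform P Z s ≤ cdf (P.map Z) c := by
  have h : ∀ᵐ s ∂P, integralTransform P Z s ≠ cdf (P.map Z) c := by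
    simpa [ae_iff] using measure_integralTransform_eq hZ hc (cdf (P.map Z) c)
  filter_upwards [h] with s hs
  refine ⟨fun hle => monotone_cdf _ hle, fun hle => ?_⟩
  by_contra! hlt
  exact hs (le_antisymm hle (monotone_cdf _ hlt.le))

lemma exists_measurableSet_ae_le_iff {Z : S → ℝ} (hZ : AEMeasurable Z P)
    (hc : ∀ c, P {s | Z s = c} = 0) {J : ℝ → ℝ}
    (hJ : StrictMonoOn J (Set.Ioo 0 1) ∨ StrictAntiOn J (Set.Ioo 0 1)) (c : ℝ) :
    ∃ B : Set ℝ, MeasurableSet B ∧ ∀ᵐ s ∂P, Z s ≤ c ↔ J (integralTransform P Z s) ∈ B := by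
  have h := ae_le_iff_integralTransform_le hZ hc c
  have h01 := ae_integralTransform_mem_Ioo hZ hc
  set u := cdf (P.map Z) c
  -- At `u = 0` or `u = 1` nothing is known of `J u`, but the event is then null or almost sure.
  rcases le_or_gt u 0 with hu0 | hu0
  · refine ⟨∅, MeasurableSet.empty, ?_⟩
    filter_upwards [h, h01] with s hs hs01
    simpa [hs] using hu0.trans_lt hs01.1
  rcases le_or_gt 1 u with hu1 | hu1
  · refine ⟨Set.univ, MeasurableSet.univ, ?_⟩
    filter_upwards [h, h01] with s hs hs01
    simpa [hs] using hs01.2.le.trans hu1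
  rcases hJ with hJ | hJ
  · refine ⟨Set.Iic (J u), measurableSet_Iic, ?_⟩
    filter_upwards [h, h01] with s hs hs01
    rw [hs, Set.mem_Iic, hJ.le_iff_le hs01 ⟨hu0, hu1⟩]
  · refine ⟨Set.Ici (J u), measurableSet_Ici, ?_⟩
    filter_upwards [h, h01] with s hs hs01
    rw [hs, Set.mem_Ici, hJ.le_iff_ge ⟨hu0, hu1⟩ hs01]

/-- Real random variables are independent as soon as their lower level sets agree almost surely
with events from independent random variables. -/
lemma iIndepFun_of_ae_le_iff {ι : Type*} [Fintype ι] {Z V : ι → S → ℝ}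
    (hZ : ∀ l, AEMeasurable (Z l) P) (hV : iIndepFun V P)
    (h : ∀ l c, ∃ B : Set ℝ, MeasurableSet B ∧ ∀ᵐ s ∂P, Z l s ≤ c ↔ V l s ∈ B) :
    iIndepFun Z P := by
  choose B hB hZB using h
  have := fun l => Measure.isProbabilityMeasure_map (hZ l)
  have hZ' : AEMeasurable (fun s l => Z l s) P := aemeasurable_pi_lambda _ hZ
  rw [iIndepFun_iff_map_fun_eq_pi_map hZ]
  symm
  -- Products of half-lines determine the joint law, so only the events `Z l ≤ c` matter.
  refine Measure.pi_eq_generateFrom (C := fun _ => Set.range Set.Iic)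
    (fun l => (borel_eq_generateFrom_Iic ℝ).symm.trans (BorelSpace.measurable_eq (α := ℝ)).symm)
    (fun l => isPiSystem_Iic)
    (fun l => ⟨fun n => Set.Iic (n : ℝ), fun n => ⟨_, rfl⟩, fun n => measure_lt_top _ _,
      Set.eq_univ_of_forall fun x => Set.mem_iUnion.2 (exists_nat_ge x)⟩) fun A hA => ?_
  choose c hcA using hA
  obtain rfl : (fun l => Set.Iic (c l)) = A := funext hcA
  rw [Measure.map_apply_of_aemeasurable hZ'
    (MeasurableSet.univ_pi fun l => measurableSet_Iic)]
  simp only [Measure.map_apply_of_aemeasurable (hZ _) measurableSet_Iic]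
  have e : ∀ l, P (Z l ⁻¹' Set.Iic (c l)) = P (V l ⁻¹' B l (c l)) := fun l =>
    measure_congr (Filter.eventuallyEq_set.2 (hZB l (c l)))
  simp only [e]
  have hprod := hV.measure_inter_preimage_eq_mul (S := Finset.univ)
    (sets := fun l => B l (c l)) fun l _ => hB l (c l)
  rw [← hprod]
  refine measure_congr (Filter.eventuallyEq_set.2 ?_)
  filter_upwards [ae_all_iff.2 fun l => hZB l (c l)] with s hs
  simp [Pi.le_def, hs]

end Independence

end ICMTest

/-! ### Limit of the integral, its positivity, and the conclusion -/

namespace ICMTest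

lemma tendsto_integral_contrast_sq {S : Type*} [MeasurableSpace S] {P : Measure S}
    [IsProbabilityMeasure P] {p : ℕ} {y : (n : ℕ) → Fin (n + 1) → Fin p → ℝ} {V : S → Fin p → ℝ}
    (hy : TendstoInDistribution y atTop V (fun n => uniformFin (n + 1)) P)
    {W : (Fin p → ℝ) → ℝ} (hW : Integrable W) :
    Tendsto (fun n => ∫ t, ‖contrast (y n) t‖ ^ 2 * W t) atTop
      (𝓝 (∫ t, ‖charContrast P V t‖ ^ 2 * W t)) := by
  refine tendsto_integral_of_dominated_convergence (fun t => 4 * ‖W t‖)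
    (fun n => ((continuous_contrast (y n)).norm.pow 2).aestronglyMeasurable.mul
      hW.aestronglyMeasurable) (hW.norm.const_mul 4)
    (fun n => ae_of_all _ fun t => ?_)
    (ae_of_all _ fun t => ((tendsto_contrast hy t).norm.pow 2).mul_const _)
  rw [norm_mul, norm_pow, norm_norm]
  have h := pow_le_pow_left₀ (norm_nonneg _) (norm_contrast_le (y n) t) 2
  exact mul_le_mul_of_nonneg_right (by linarith) (norm_nonneg _)

/-- The weighted squared contrast of characteristic functions has a positive integral unless the
components are independent. -/
lemma integral_charContrast_sq_pos {S : Type*} [MeasurableSpace S] {P : Measure S}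
    [IsProbabilityMeasure P] {p : ℕ} {V : S → Fin p → ℝ} (hV : AEMeasurable V P)
    {W : (Fin p → ℝ) → ℝ} (hWpos : ∀ᵐ t, 0 < W t) (hW : Integrable W)
    (hdep : ¬ iIndepFun (fun l s => V s l) P) :
    0 < ∫ t, ‖charContrast P V t‖ ^ 2 * W t := by
  have hcont := continuous_charContrast hV
  have hbound : ∀ t, ‖charContrast P V t‖ ≤ 2 := fun t => by
    have hphase : ∀ f : S → ℝ, ‖∫ s, Complex.exp (Complex.I * (f s : ℂ)) ∂P‖ ≤ 1 := fun f => by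
      simpa using norm_integral_le_of_norm_le_const (μ := P) (C := 1)
        (ae_of_all _ fun s => (norm_phase (f s)).le)
    refine (norm_sub_le _ _).trans ?_
    have h : ‖∏ l, ∫ s, Complex.exp (Complex.I * ((t l * V s l : ℝ) : ℂ)) ∂P‖ ≤ 1 := by
      rw [norm_prod]
      exact Finset.prod_le_one (fun _ _ => norm_nonneg _) fun l _ => hphase _
    linarith [hphase fun s => t ⬝ᵥ V s]
  have hnonneg : 0 ≤ᵐ[volume] fun t => ‖charContrast P V t‖ ^ 2 * W t := by
    filter_upwards [hWpos] with t ht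
    exact mul_nonneg (by positivity) ht.le
  have hint : Integrable fun t => ‖charContrast P V t‖ ^ 2 * W t := by
    refine hW.bdd_mul (c := 4) (hcont.norm.pow 2).aestronglyMeasurable (ae_of_all _ fun t => ?_)
    rw [norm_pow, norm_norm]
    have h := pow_le_pow_left₀ (norm_nonneg _) (hbound t) 2
    linarith
  -- A zero integral with `W > 0` makes the contrast vanish almost everywhere, hence everywhere by
  -- continuity.
  refine (integral_nonneg_of_ae hnonneg).lt_of_ne fun h0 => hdep ?_
  have hzero := (integral_eq_zero_iff_of_nonneg_ae hnonneg hint).1 h0.symm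
  have hae : charContrast P V =ᵐ[volume] fun _ => 0 := by
    filter_upwards [hzero, hWpos] with t ht htW
    simpa [htW.ne'] using ht
  exact iIndepFun_of_charContrast_eq_zero hV
    (congrFun ((hcont.ae_eq_iff_eq volume continuous_const).1 hae))

/-- If the scored integral transforms of the pseudo-residual are independent, then the independent
component model holds. -/
lemma nullHypothesis_of_iIndepFun_score {S : Type*} [MeasurableSpace S] {P : Measure S}
    [IsProbabilityMeasure P] {p : ℕ} {X : S → Fin p → ℝ} (hX : AEMeasurable X P)
    {J : Fin p → ℝ → ℝ}
    (hJ : ∀ l, StrictMonoOn (J l) (Set.Ioo 0 1) ∨ StrictAntiOn (J l) (Set.Ioo 0 1))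
    {Ωt : Matrix (Fin p) (Fin p) ℝ} (hΩt : IsUnit Ωt.det)
    (hcont : ∀ (l : Fin p) (c : ℝ), P {s | (Ωt⁻¹ *ᵥ X s) l = c} = 0)
    (hV : iIndepFun (fun l s => J l (integralTransform P (fun s => (Ωt⁻¹ *ᵥ X s) l) s)) P) :
    NullHypothesis P X := by
  have hZ : AEMeasurable (fun s => Ωt⁻¹ *ᵥ X s) P :=
    (continuous_const.matrix_mulVec continuous_id).measurable.comp_aemeasurable hX
  have hZl : ∀ l, AEMeasurable (fun s => (Ωt⁻¹ *ᵥ X s) l) P := fun l =>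
    (measurable_pi_apply l).comp_aemeasurable hZ
  -- The pseudo-residual itself serves as latent vector; it is uncentred, so the location is 0.
  refine ⟨0, Ωt, fun s => Ωt⁻¹ *ᵥ X s, hΩt, hZ, ?_, ae_of_all _ fun s => ?_⟩
  · exact iIndepFun_of_ae_le_iff hZl hV fun l c =>
      exists_measurableSet_ae_le_iff (hZl l) (hcont l) (hJ l) c
  · rw [Matrix.mulVec_mulVec, Matrix.mul_nonsing_inv _ hΩt, Matrix.one_mulVec, zero_add]

end ICMTest

theorem proposition2
    {S : Type*} [MeasurableSpace S] (P : Measure S) [IsProbabilityMeasure P]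
    (p : ℕ) (hp : 1 < p)
    -- the observed random vector and a sequence of independent copies of it
    (X : S → Fin p → ℝ) (Xs : ℕ → S → Fin p → ℝ)
    (hindep : iIndepFun Xs P) (hident : ∀ j, IdentDistrib (Xs j) X P P)
    -- the weight function
    (W : (Fin p → ℝ) → ℝ) (hWpos : ∀ᵐ t, 0 < W t) (hWint : Integrable W)
    -- the score functions on (0, 1)
    (J : Fin p → ℝ → ℝ)
    (hJ : ∀ l, StrictMonoOn (J l) (Set.Ioo 0 1) ∨ StrictAntiOn (J l) (Set.Ioo 0 1))
    -- the estimators of location and mixing matrix, as functions of the sample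
    (μhat : (n : ℕ) → (Fin n → Fin p → ℝ) → Fin p → ℝ)
    (Ωhat : (n : ℕ) → (Fin n → Fin p → ℝ) → Matrix (Fin p) (Fin p) ℝ)
    -- strong convergence to a full-rank pseudo-true value
    (Ωt : Matrix (Fin p) (Fin p) ℝ) (hΩt : IsUnit Ωt.det)
    (hconv : ∀ᵐ s ∂P,
      Tendsto (fun n : ℕ => Ωhat n (fun j : Fin n => Xs j s)) atTop (𝓝 Ωt))
    -- the components of the pseudo-residual have continuous distributions
    (hcont : ∀ (l : Fin p) (c : ℝ), P {s | (Ωt⁻¹ *ᵥ X s) l = c} = 0)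
    -- the alternative
    (halt : ¬ ICMTest.NullHypothesis P X) :
    ∀ᵐ s ∂P,
      Tendsto
        (fun n : ℕ => ICMTest.rankStatistic W J
          (μhat n (fun j : Fin n => Xs j s)) (Ωhat n (fun j : Fin n => Xs j s))
          (fun j : Fin n => Xs j s))
        atTop atTop := by
  have hX : AEMeasurable X P := (hident 0).aemeasurable_snd
  filter_upwards [ICMTest.ae_tendstoInDistribution_uniformFin hindep hident, hconv] with s hs hΩ
  have hV := ICMTest.tendstoInDistribution_scoredRank (x := fun j => Xs j s) hs hJ
    (fun n => μhat (n + 1) fun j : Fin (n + 1) => Xs j s) hΩt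
    ((tendsto_add_atTop_iff_nat 1).2 hΩ) hcont
  have hpos := ICMTest.integral_charContrast_sq_pos hV.aemeasurable_limit hWpos hWint fun h =>
    halt (ICMTest.nullHypothesis_of_iIndepFun_score hX hJ hΩt hcont h)
  -- Sample sizes `n + 1` exclude the empty sample, which carries no uniform probability.
  refine (tendsto_add_atTop_iff_nat 1).1 ?_
  exact (tendsto_natCast_atTop_atTop.comp (tendsto_add_atTop_nat 1)).atTop_mul_pos hpos
    (ICMTest.tendsto_integral_contrast_sq hV hWint)
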